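/- Let $H:\mathbb R^N\times\mathbb R^N\to\mathbb R$ be a continuous function such that - $H(x,\cdot)$ is convex for every $x\in\mathbb R^N$, and $H$ is coercive in $p$ locally uniformly in $x$: for every $R>0$, $\lim_{r\to\infty}\inf\{H(x,p)\mid |x|<R,\ |p|\ge r\}=+\infty$; - there exists $\varepsilon>0$ such that $\limsup_{|x|\to\infty}\,\sup_{|p|<\varepsilon}H(x,p)<\sup_{x\in\mathbb R^N}\,\inf_{p\in\mathbb R^N}H(x,p)$. Let $c=\inf\{a\in\mathbb R\mid H(x,Du)=a \text{ admits a viscosity subsolution in } \mathbb R^N\}$ be the critical value of $H$. Here viscosity subsolutions are upper semicontinuous, viscosity supersolutions are lower semicontinuous, and viscosity solutions are functions that are both. Then for every $\lambda>0$ the discounted equation $$\lambda u+H(x,Du)=c\quad\text{in }\mathbb R^N$$ has a maximal viscosity solution $u_\lambda$, that is, a viscosity solution that satisfies $v\le u_\lambda$ in $\mathbb R^N$ for every viscosity subsolution $v$ of the same equation, and $u_\lambda$ is locally Lipschitz continuous. Moreover, the family $\{u_\lambda\}_{\lambda>0}$ is equibounded from below, i.e. there is $m\in\mathbb R$ with $u_\lambda(x)\ge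 m$ for all $\lambda>0$ and $x\in\mathbb R^N$, and it is relatively compact in $C(\mathbb R^N)$ with the topology of locally uniform convergence. -/

import Mathlib

namespace DiscountedHJ

open Filter Topology Set

/-- `ℝ^N` with its Euclidean norm and scalar product. -/
abbrev Space (N : ℕ) := EuclideanSpace ℝ (Fin N)

/-- Joint continuity of the Hamiltonian in `(x, p)`. -/
def HamContinuous {N : ℕ} (H : Space N → Space N → ℝ) : Prop :=
  Continuous (fun z : Space N × Space N => H z.1 z.2)

/-- Convexity in the momentum variable. -/
def HamConvex {N : ℕ} (H : Space N → Space N → ℝ) : Prop :=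
  ∀ x, ConvexOn ℝ univ (H x)

/-- Coercivity in the momentum variable, locally uniformly in `x`: for any `R > 0`,
`inf {H(x,p) | x ∈ B_R, p ∉ B_r} → +∞` as `r → ∞`. -/
def HamCoercive {N : ℕ} (H : Space N → Space N → ℝ) : Prop :=
  ∀ R : ℝ, 0 < R →
    Tendsto (fun r : ℝ =>
        ⨅ x ∈ Metric.ball (0 : Space N) R, ⨅ p ∈ (Metric.ball (0 : Space N) r)ᶜ, (H x p : EReal))
      atTop (𝓝 ⊤)

/-- The condition at infinity: for some `ε > 0`,
`limsup_{|x| → ∞} max_{p ∈ B_ε} H(x,p) < max_x min_p H(x,p)`, with extended real values. -/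
def HamInfinity {N : ℕ} (H : Space N → Space N → ℝ) : Prop :=
  ∃ ε : ℝ, 0 < ε ∧
    limsup (fun x : Space N => ⨆ p ∈ Metric.ball (0 : Space N) ε, (H x p : EReal))
        (cocompact (Space N))
      < ⨆ x : Space N, ⨅ p : Space N, (H x p : EReal)

/-- `u` is a viscosity subsolution of `lam * u + H(x, Du) = a` in `ℝ^N`. Test functions are of
class `C^1` in a neighbourhood of the touching point. -/
def IsSubsolution {N : ℕ} (H : Space N → Space N → ℝ) (lam a : ℝ) (u : Space N → ℝ) : Prop :=
  UpperSemicontinuous u ∧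
    ∀ (x : Space N) (φ : Space N → ℝ), ContDiffAt ℝ 1 φ x →
      IsLocalMax (fun y => u y - φ y) x → lam * u x + H x (gradient φ x) ≤ a

/-- `u` is a viscosity supersolution of `lam * u + H(x, Du) = a` in `ℝ^N`. -/
def IsSupersolution {N : ℕ} (H : Space N → Space N → ℝ) (lam a : ℝ) (u : Space N → ℝ) : Prop :=
  LowerSemicontinuous u ∧
    ∀ (x : Space N) (φ : Space N → ℝ), ContDiffAt ℝ 1 φ x →
      IsLocalMin (fun y => u y - φ y) x → a ≤ lam * u x + H x (gradient φ x)

/-- `u` is a (continuous) viscosity solution of `lam * u + H(x, Du) = a` in `ℝ^N`. -/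
def IsSolution {N : ℕ} (H : Space N → Space N → ℝ) (lam a : ℝ) (u : Space N → ℝ) : Prop :=
  IsSubsolution H lam a u ∧ IsSupersolution H lam a u

/-- The critical value `c = inf {a | H(x, Du) = a admits subsolutions in ℝ^N}`. -/
noncomputable def criticalValue {N : ℕ} (H : Space N → Space N → ℝ) : ℝ :=
  sInf {a : ℝ | ∃ u : Space N → ℝ, IsSubsolution H 0 a u}

/-- `u` is the maximal solution of `lam * u + H(x, Du) = a`: it is a solution, and it lies above
every subsolution (in particular above every solution). -/
def IsMaximalSolution {N : ℕ} (H : Space N → Space N → ℝ) (lam a : ℝ) (u : Space N → ℝ) : Prop :=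
  IsSolution H lam a u ∧ ∀ v : Space N → ℝ, IsSubsolution H lam a v → ∀ x, v x ≤ u x

end DiscountedHJ

/-!
The maximal solution comes from Perron's method, as the supremum `u` of the subsolutions `v` with
`lam * v ≥ -C`, where `C` is so large that the constant `-C / lam` is one of them. These `v` satisfy
`H(x, Dv) ≤ c + C`, so coercivity makes them locally Lipschitz with constants independent of `lam`,
and `u` inherits these constants.

Outside a large ball `B` the constants are subsolutions of `H = a` for some `a < c`. If `v` were
positive on `B`, then `max v k` with a small constant `k > 0` would be a subsolution of `H = b` for
some `b < c`, contradicting the minimality of `c`. Hence `v ≤ 0` somewhere in `B`, which bounds `u`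
above locally, uniformly in `lam`.

For the lower bound, a subsolution `w` of `H = c + min lam 1` is normalized to lie in `[-K, 0)` on
`B`. Outside `B` constants are subsolutions, so there `w` can be compressed from above and cut off
from below, which yields a bounded subsolution; lowering it by a constant gives a subsolution of the
discounted equation with a lower bound independent of `lam`. Relative compactness is then the
Arzelà–Ascoli theorem.
-/

namespace DiscountedHJ

open Filter Topology Set Metric
open scoped NNReal

section Metric

variable {X : Type*} [PseudoMetricSpace X]

lemma exists_isMaxOn_closedBall_of_lt_on_sphere [ProperSpace X] {α : Type*} [LinearOrder α]
    {f : X → α} {x : X} {r : ℝ} (hr : 0 ≤ r) (hf : UpperSemicontinuousOn f (closedBall x r))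
    (hlt : ∀ y ∈ sphere x r, f y < f x) : ∃ y ∈ ball x r, IsMaxOn f (closedBall x r) y := by
  have hx : x ∈ closedBall x r := mem_closedBall_self hr
  obtain ⟨y, hy, hmax⟩ := hf.exists_isMaxOn ⟨x, hx⟩ (isCompact_closedBall x r)
  exact ⟨y, lt_of_le_of_ne hy fun hyr => (hlt y hyr).not_ge (hmax hx), hmax⟩

lemma exists_pos_forall_closedBall_of_eventually_nhds_prod {x : X} {P : X × ℝ → Prop}
    (h : ∀ᶠ z in 𝓝 (x, (0 : ℝ)), P z) :
    ∃ r > 0, ∀ y ∈ closedBall x r, ∀ t, |t| ≤ r ^ 2 → P (y, t) := by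
  obtain ⟨ρ, hρ, hP⟩ := nhds_basis_closedBall.eventually_iff.1 h
  have hr : 0 < min ρ 1 := lt_min hρ one_pos
  refine ⟨min ρ 1, hr, fun y hy t ht => hP ?_⟩
  have hsq : min ρ 1 ^ 2 ≤ ρ :=
    (pow_le_of_le_one hr.le (min_le_right _ _) two_ne_zero).trans (min_le_left _ _)
  rw [mem_closedBall, Prod.dist_eq, max_le_iff, Real.dist_eq, sub_zero]
  exact ⟨(mem_closedBall.1 hy).trans (min_le_left _ _), ht.trans hsq⟩

lemma lipschitzOnWith_of_isLUB {F : Set (X → ℝ)} {u : X → ℝ} {s : Set X} {K : ℝ≥0}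
    (hF : ∀ v ∈ F, LipschitzOnWith K v s) (hu : ∀ x ∈ s, IsLUB ((fun v => v x) '' F) (u x)) :
    LipschitzOnWith K u s := by
  refine LipschitzOnWith.of_le_add_mul K fun x hx y hy => (hu x hx).2 ?_
  rintro _ ⟨v, hv, rfl⟩
  exact ((hF v hv).le_add_mul hx hy).trans
    (add_le_add_left ((hu y hy).1 (mem_image_of_mem _ hv)) _)

lemma locallyLipschitz_of_lipschitzOnWith_ball {Y : Type*} [PseudoMetricSpace Y] {f : X → Y} (z : X)
    (hf : ∀ R, ∃ K, LipschitzOnWith K f (ball z R)) : LocallyLipschitz f := fun x =>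
  let ⟨K, hK⟩ := hf (dist x z + 1)
  ⟨K, _, isOpen_ball.mem_nhds (mem_ball.2 (lt_add_one _)), hK⟩

lemma equicontinuous_of_lipschitzOnWith_nhds {ι Y : Type*} [PseudoMetricSpace Y] {F : ι → X → Y}
    (hF : ∀ x, ∃ K, ∃ U ∈ 𝓝 x, ∀ i, LipschitzOnWith K (F i) U) : Equicontinuous F := by
  intro x
  obtain ⟨K, U, hU, hK⟩ := hF x
  refine equicontinuousAt_of_continuity_modulus (fun y => K * dist x y)
    (Continuous.tendsto' (by fun_prop) x 0 (by simp)) F ?_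
  filter_upwards [hU] with y hy i
  exact (hK i).dist_le_mul x (mem_of_mem_nhds hU) y hy

end Metric

lemma upperSemicontinuousAt_of_eventuallyEq {X β : Type*} [TopologicalSpace X] [Preorder β]
    {f g : X → β} {x : X} (hf : UpperSemicontinuousAt f x) (hfg : f =ᶠ[𝓝 x] g) :
    UpperSemicontinuousAt g x := fun b hb => by
  filter_upwards [hf b (hfg.eq_of_nhds.trans_lt hb), hfg] with y hy hfgy
  exact hfgy.symm.trans_lt hy

lemma isCompact_closure_of_equicontinuous {X α : Type*} [TopologicalSpace X]
    [WeaklyLocallyCompactSpace X] [UniformSpace α] [T2Space α] [CompleteSpace α] {S : Set C(X, α)}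
    (hS : Equicontinuous ((↑) : S → X → α))
    (hpt : ∀ x, ∃ Q, IsCompact Q ∧ ∀ f ∈ S, f x ∈ Q) : IsCompact (closure S) := by
  have : T2Space (UniformOnFun X α {K | IsCompact K}) :=
    UniformOnFun.t2Space_of_covering sUnion_isCompact_eq_univ
  exact ArzelaAscoli.isCompact_closure_of_isClosedEmbedding
    (F := fun f : C(X, α) => (f : X → α)) (𝔖 := {K | IsCompact K}) (fun _ => id)
    ContinuousMap.isUniformEmbedding_toUniformOnFunIsCompact.isClosedEmbedding
    (fun K _ => hS.equicontinuousOn K) fun _ _ x _ => hpt x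

section Superdifferential

variable {E : Type*} [NormedAddCommGroup E] [InnerProductSpace ℝ E]

lemma gradient_comp [CompleteSpace E] {γ : ℝ → ℝ} {γ' : ℝ} {f : E → ℝ} {x : E}
    (hγ : HasDerivAt γ γ' (f x)) (hf : DifferentiableAt ℝ f x) :
    gradient (fun y => γ (f y)) x = γ' • gradient f x := by
  have h := (hγ.comp_hasFDerivAt x hf.hasFDerivAt).fderiv
  simp only [Function.comp_def] at h
  rw [gradient, h, map_smul, gradient]

lemma gradient_add_mul_norm_sub_sq [CompleteSpace E] {φ : E → ℝ} {y : E}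
    (hφ : DifferentiableAt ℝ φ y) (x : E) (A : ℝ) :
    gradient (fun z => φ z + A * ‖z - x‖ ^ 2) y = gradient φ y + (2 * A) • (y - x) := by
  have hsq : HasFDerivAt (fun z : E => ‖z - x‖ ^ 2) (2 • innerSL ℝ (y - x)) y :=
    (hasStrictFDerivAt_norm_sq (y - x)).hasFDerivAt.comp (f := fun z : E => z - x) y
      ((hasFDerivAt_id y).sub_const x)
  refine HasGradientAt.gradient (hasGradientAt_iff_hasFDerivAt.2 ?_)
  refine (hφ.hasFDerivAt.add (hsq.const_mul A)).congr_fderiv ?_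
  ext z
  simp
  ring

lemma contDiffAt_norm_sub {x y : E} (hxy : y ≠ x) : ContDiffAt ℝ 1 (fun z => ‖z - x‖) y :=
  (contDiffAt_id.sub contDiffAt_const).norm ℝ (sub_ne_zero.2 hxy)

lemma norm_gradient_norm_sub [CompleteSpace E] {x y : E} (hxy : y ≠ x) :
    ‖gradient (fun z => ‖z - x‖) y‖ = 1 := by
  have : Nontrivial E := ⟨y, x, hxy⟩
  have hd : DifferentiableAt ℝ (‖·‖) (y - x) :=
    (contDiffAt_norm ℝ (sub_ne_zero.2 hxy) (n := 1)).differentiableAt one_ne_zero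
  rw [← LinearIsometryEquiv.norm_map (InnerProductSpace.toDual ℝ E), toDual_gradient,
    fderiv_comp_sub (f := fun z : E => ‖z‖), norm_fderiv_norm hd]

lemma continuousAt_gradient [CompleteSpace E] {φ : E → ℝ} {x : E} (hφ : ContDiffAt ℝ 1 φ x) :
    ContinuousAt (gradient φ) x :=
  (InnerProductSpace.toDual ℝ E).symm.continuous.continuousAt.comp
    (hφ.continuousAt_fderiv one_ne_zero)

lemma eventually_contDiffAt {φ : E → ℝ} {x : E} (hφ : ContDiffAt ℝ 1 φ x) :
    ∀ᶠ y in 𝓝 x, ContDiffAt ℝ 1 φ y :=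
  hφ.eventually (by simp)

/-- The superdifferential `D⁺u(x)`: the gradients at `x` of the functions that are of class `C¹`
near `x` and touch `u` from above at `x`. Viscosity subsolutions are described through it. -/
def superdifferential [CompleteSpace E] (u : E → ℝ) (x : E) : Set E :=
  {p | ∃ φ : E → ℝ, ContDiffAt ℝ 1 φ x ∧ (∀ᶠ y in 𝓝 x, u y ≤ φ y) ∧ φ x = u x ∧ gradient φ x = p}

lemma gradient_mem_superdifferential [CompleteSpace E] {u φ : E → ℝ} {x : E}
    (hφ : ContDiffAt ℝ 1 φ x) (hmax : IsLocalMax (fun y => u y - φ y) x) :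
    gradient φ x ∈ superdifferential u x := by
  refine ⟨fun y => φ y + (u x - φ x), hφ.add contDiffAt_const, ?_, by ring, ?_⟩
  · filter_upwards [hmax] with y hy
    linarith
  · simp only [gradient, fderiv_add_const]

lemma superdifferential_subset_of_eventually_le [CompleteSpace E] {v w : E → ℝ} {x : E}
    (hle : ∀ᶠ y in 𝓝 x, v y ≤ w y) (hx : v x = w x) :
    superdifferential w x ⊆ superdifferential v x := by
  rintro p ⟨φ, hφ, hwφ, hφx, hgrad⟩
  exact ⟨φ, hφ, hle.mp (hwφ.mono fun _ h h' => h'.trans h), hφx.trans hx.symm, hgrad⟩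

lemma superdifferential_subset_singleton [CompleteSpace E] {ψ : E → ℝ} {x : E}
    (hψ : DifferentiableAt ℝ ψ x) : superdifferential ψ x ⊆ {gradient ψ x} := by
  rintro _ ⟨φ, hφ, hle, hφx, rfl⟩
  have hmax : IsLocalMax (fun y => ψ y - φ y) x := by
    filter_upwards [hle] with y hy
    linarith
  have hfderiv := hmax.fderiv_eq_zero
  rw [fderiv_fun_sub hψ (hφ.differentiableAt one_ne_zero), sub_eq_zero] at hfderiv
  rw [mem_singleton_iff, gradient, gradient, hfderiv]

lemma eq_zero_of_mem_superdifferential_const [CompleteSpace E] {k : ℝ} {x p : E}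
    (hp : p ∈ superdifferential (fun _ => k) x) : p = 0 := by
  have h := superdifferential_subset_singleton (differentiableAt_const k) hp
  rwa [gradient_fun_const] at h

lemma superdifferential_sub_const_subset [CompleteSpace E] (u : E → ℝ) (k : ℝ) (x : E) :
    superdifferential (fun y => u y - k) x ⊆ superdifferential u x := by
  rintro _ ⟨φ, hφ, hle, hφx, rfl⟩
  refine gradient_mem_superdifferential hφ ?_
  filter_upwards [hle] with y hy
  linarith

lemma smul_mem_superdifferential_comp [CompleteSpace E] {v : E → ℝ} {γ : ℝ → ℝ} {I : Set ℝ}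
    {x p : E} (hI : I ∈ 𝓝 (v x)) (hmono : MonotoneOn γ I) (hγ : ContDiffAt ℝ 1 γ (v x))
    (hv : ∀ᶠ y in 𝓝 x, v y ∈ I) (hp : p ∈ superdifferential v x) :
    deriv γ (v x) • p ∈ superdifferential (fun y => γ (v y)) x := by
  obtain ⟨φ, hφ, hle, hφx, rfl⟩ := hp
  rw [← hφx] at hI hγ ⊢
  refine ⟨fun y => γ (φ y), hγ.comp x hφ, ?_, congrArg γ hφx, ?_⟩
  · filter_upwards [hle, hv, hφ.continuousAt hI] with y hy hvy hφy
    exact hmono hvy hφy hy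
  · exact gradient_comp (hγ.differentiableAt one_ne_zero).hasDerivAt
      (hφ.differentiableAt one_ne_zero)

section ProperSpace

variable [ProperSpace E]

lemma exists_gradient_add_mem_superdifferential {v φ : E → ℝ} {x : E} {r A : ℝ} (hr : 0 ≤ r)
    (hv : UpperSemicontinuous v) (hφ : ∀ y ∈ closedBall x r, ContDiffAt ℝ 1 φ y)
    (hle : ∀ y ∈ closedBall x r, v y ≤ φ y) (hx : φ x - A * r ^ 2 < v x) :
    ∃ y ∈ ball x r, gradient φ y + (2 * A) • (y - x) ∈ superdifferential v y ∧
      φ y - A * r ^ 2 < v y := by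
  set ψ : E → ℝ := fun y => φ y + A * ‖y - x‖ ^ 2 with hψ_def
  have hψx : ψ x = φ x := by simp [hψ_def]
  have hψ : ∀ y ∈ closedBall x r, ContDiffAt ℝ 1 ψ y := fun y hy =>
    (hφ y hy).add (contDiff_const.mul ((contDiff_id.sub contDiff_const).norm_sq ℝ)).contDiffAt
  have husc : UpperSemicontinuousOn (fun y => v y - ψ y) (closedBall x r) :=
    (hv.upperSemicontinuousOn _).add (ContinuousOn.upperSemicontinuousOn
      fun y hy => (hψ y hy).continuousAt.continuousWithinAt.neg)
  obtain ⟨y, hy, hmax⟩ := exists_isMaxOn_closedBall_of_lt_on_sphere hr husc fun y hy => by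
    have hvy := hle y (sphere_subset_closedBall hy)
    rw [hψx]
    simp only [hψ_def, mem_sphere_iff_norm.1 hy]
    linarith
  have hyr := ball_subset_closedBall hy
  refine ⟨y, hy, ?_, ?_⟩
  · rw [← gradient_add_mul_norm_sub_sq ((hφ y hyr).differentiableAt one_ne_zero)]
    exact gradient_mem_superdifferential (hψ y hyr)
      (hmax.isLocalMax (closedBall_mem_nhds_of_mem hy))
  · have hxr : x ∈ closedBall x r := mem_closedBall_self hr
    have hvψ : v x - φ x ≤ v y - (φ y + A * ‖y - x‖ ^ 2) := hψx ▸ hmax hxr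
    have hA : 0 ≤ A := by
      by_contra! hA
      nlinarith [hle x hxr, mul_nonneg (neg_pos.2 hA).le (sq_nonneg r)]
    linarith [mul_nonneg hA (sq_nonneg ‖y - x‖)]

lemma exists_superdifferential_nonempty {u : E → ℝ} (hu : UpperSemicontinuous u) (x : E) {r : ℝ}
    (hr : 0 < r) : ∃ y ∈ ball x r, (superdifferential u y).Nonempty := by
  obtain ⟨M, hM⟩ := (hu.upperSemicontinuousOn _).bddAbove_of_isCompact (isCompact_closedBall x r)
  obtain ⟨y, hy, hp, -⟩ := exists_gradient_add_mem_superdifferential (φ := fun _ => M)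
    (A := (M - u x + 1) / r ^ 2) hr.le hu (fun _ _ => contDiffAt_const)
    (fun y hy => hM (mem_image_of_mem u hy)) (by
      rw [div_mul_cancel₀ _ (by positivity)]
      linarith)
  exact ⟨y, hy, _, hp⟩

lemma le_add_of_norm_le_of_mem_superdifferential {u : E → ℝ} {x : E} {s L : ℝ} {g : ℝ → ℝ}
    (hs : 0 ≤ s) (hu : UpperSemicontinuous u)
    (hp : ∀ y ∈ ball x s, ∀ p ∈ superdifferential u y, ‖p‖ ≤ L) (hg : ContDiff ℝ 1 g)
    (hg₀ : g 0 = 0) (hg' : ∀ t > 0, L < deriv g t) (hsphere : ∀ y ∈ sphere x s, u y < u x + g s) :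
    ∀ y ∈ closedBall x s, u y ≤ u x + g ‖y - x‖ := by
  have hcont : Continuous fun y => g ‖y - x‖ := hg.continuous.comp (by fun_prop)
  have husc : UpperSemicontinuousOn (fun y => u y - g ‖y - x‖) (closedBall x s) :=
    (hu.add hcont.neg.upperSemicontinuous).upperSemicontinuousOn _
  obtain ⟨z, hz, hmax⟩ := exists_isMaxOn_closedBall_of_lt_on_sphere hs husc fun y hy => by
    rw [mem_sphere_iff_norm.1 hy, sub_self, norm_zero, hg₀]
    linarith [hsphere y hy]
  have hzx : z = x := by
    by_contra hne
    have hnorm := contDiffAt_norm_sub hne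
    have hmem := gradient_mem_superdifferential (hg.contDiffAt.comp z hnorm)
      (hmax.isLocalMax (closedBall_mem_nhds_of_mem hz))
    have hle := hp z hz _ hmem
    rw [Function.comp_def, gradient_comp (hg.differentiable one_ne_zero _).hasDerivAt
      (hnorm.differentiableAt one_ne_zero), norm_smul, norm_gradient_norm_sub hne, mul_one] at hle
    exact ((hg' _ (norm_pos_iff.2 (sub_ne_zero.2 hne))).trans_le (le_abs_self _)).not_ge hle
  intro y hy
  have hyz : u y - g ‖y - x‖ ≤ u z - g ‖z - x‖ := hmax hy
  rw [hzx, sub_self, norm_zero, hg₀] at hyz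
  linarith

end ProperSpace

lemma exists_contDiff_deriv_gt_of_lt {ρ s ε : ℝ} (hρ : 0 < ρ) (hρs : ρ < s) (hε : 0 < ε)
    (L M : ℝ) : ∃ g : ℝ → ℝ, ContDiff ℝ 1 g ∧ g 0 = 0 ∧ (∀ t > 0, L < deriv g t) ∧
      g ρ = L * ρ + ε ∧ M < g s := by
  set δ := ε / (ρ + 1) with hδ_def
  have hδ : 0 < δ := by positivity
  have hε_eq : ε = δ * (ρ + 1) := by rw [hδ_def]; field_simp
  have hsρ : 1 < s / ρ := (one_lt_div hρ).2 hρs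
  obtain ⟨n, hn⟩ := pow_unbounded_of_one_lt ((M - (L + δ) * s) / δ) hsρ
  refine ⟨fun t => (L + δ) * t + δ * (t / ρ) ^ (n + 1), by fun_prop, by simp, fun t ht => ?_, ?_,
    ?_⟩
  · have hderiv : HasDerivAt (fun t => (L + δ) * t + δ * (t / ρ) ^ (n + 1))
        ((L + δ) * 1 + δ * ((n + 1 : ℕ) * (t / ρ) ^ n * (1 / ρ))) t :=
      ((hasDerivAt_id t).const_mul (L + δ)).add
        ((((hasDerivAt_id t).div_const ρ).pow (n + 1)).const_mul δ)
    have hpos : 0 ≤ δ * ((n + 1 : ℕ) * (t / ρ) ^ n * (1 / ρ)) := by positivity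
    rw [hderiv.deriv]
    linarith
  · beta_reduce
    rw [div_self hρ.ne', one_pow, hε_eq]
    ring
  · have hpow : (s / ρ) ^ n ≤ (s / ρ) ^ (n + 1) := pow_le_pow_right₀ hsρ.le n.le_succ
    linarith [(div_lt_iff₀' hδ).1 (hn.trans_le hpow)]

lemma lipschitzOnWith_of_superdifferential [ProperSpace E] {u : E → ℝ} {z : E} {R : ℝ} {L : ℝ≥0}
    (hu : UpperSemicontinuous u)
    (hp : ∀ y ∈ ball z (3 * R), ∀ p ∈ superdifferential u y, ‖p‖ ≤ L) :
    LipschitzOnWith L u (ball z R) := by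
  refine LipschitzOnWith.of_le_add_mul L fun y hy x hx => ?_
  rcases eq_or_ne y x with rfl | hne
  · simp
  have hdist : dist y x < 2 * R := by
    linarith [dist_triangle_right y x z, mem_ball.1 hx, mem_ball.1 hy]
  obtain ⟨s, hys, hs⟩ := exists_between hdist
  have hρ : 0 < dist y x := dist_pos.2 hne
  have hball : ball x s ⊆ ball z (3 * R) := ball_subset_ball' (by linarith [mem_ball.1 hx])
  obtain ⟨M, hM⟩ := (hu.upperSemicontinuousOn _).bddAbove_of_isCompact (isCompact_closedBall x s)
  refine le_of_forall_pos_le_add fun ε hε => ?_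
  -- The barrier `g` nearly equals `L * t` at `t = dist y x` but exceeds `M - u x` at `t = s`.
  obtain ⟨g, hg, hg₀, hg', hgρ, hgs⟩ := exists_contDiff_deriv_gt_of_lt hρ hys hε L (M - u x)
  have hle := le_add_of_norm_le_of_mem_superdifferential (hρ.trans hys).le hu
    (fun w hw => hp w (hball hw)) hg hg₀ hg' (fun w hw => by
      linarith [hM (mem_image_of_mem u (sphere_subset_closedBall hw))]) y (mem_closedBall.2 hys.le)
  rw [← dist_eq_norm, hgρ] at hle
  linarith

lemma mem_closure_superdifferential_of_isLUB [ProperSpace E] {S : Set (E → ℝ)} {u : E → ℝ}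
    (hS : ∀ v ∈ S, UpperSemicontinuous v) (hu : ∀ y, IsLUB ((fun v => v y) '' S) (u y)) {x p : E}
    (hp : p ∈ superdifferential u x) :
    (x, u x, p) ∈ closure {z : E × ℝ × E | ∃ v ∈ S,
      z.2.1 = v z.1 ∧ z.2.2 ∈ superdifferential v z.1} := by
  obtain ⟨φ, hφ, hle, hφx, rfl⟩ := hp
  rw [mem_closure_iff_nhds]
  intro U hU
  -- Members of `S` nearly reaching `u x` are touched near `x` by `φ` plus a small quadratic.
  set F : E × ℝ → E × ℝ × E := fun z =>
    (z.1, φ z.1 + z.2, gradient φ z.1 + (2 * (1 : ℝ)) • (z.1 - x)) with hF_def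
  have hF : ContinuousAt F (x, 0) := by
    have hφ_fst : ContinuousAt (fun z : E × ℝ => φ z.1) (x, 0) :=
      hφ.continuousAt.fst''
    have hgrad_fst : ContinuousAt (fun z : E × ℝ => gradient φ z.1) (x, 0) :=
      (continuousAt_gradient hφ).fst''
    exact continuousAt_fst.prodMk ((hφ_fst.add continuousAt_snd).prodMk
      (hgrad_fst.add (by fun_prop)))
  have hFx : F (x, 0) = (x, u x, gradient φ x) := by simp [hF_def, hφx]
  obtain ⟨r, hr, hP⟩ := exists_pos_forall_closedBall_of_eventually_nhds_prod
    ((hF.eventually_mem (hFx ▸ hU)).and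
      ((hle.and (eventually_contDiffAt hφ)).prod_inl_nhds 0))
  have hball : ∀ y ∈ closedBall x r, u y ≤ φ y ∧ ContDiffAt ℝ 1 φ y := fun y hy =>
    (hP y hy 0 (by simpa using sq_nonneg r)).2
  obtain ⟨_, ⟨v, hvS, rfl⟩, hvx, -⟩ := (hu x).exists_between (sub_lt_self (u x) (pow_pos hr 2))
  have hvφ : ∀ y ∈ closedBall x r, v y ≤ φ y := fun y hy =>
    ((hu y).1 (mem_image_of_mem _ hvS)).trans (hball y hy).1
  obtain ⟨y, hy, hmem, hvy⟩ := exists_gradient_add_mem_superdifferential (A := 1) hr.le (hS v hvS)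
    (fun y hy => (hball y hy).2) hvφ (by rwa [one_mul, hφx])
  have hyr := ball_subset_closedBall hy
  refine ⟨F (y, v y - φ y), (hP y hyr _ ?_).1, v, hvS, add_sub_cancel _ _, hmem⟩
  rw [abs_sub_comm, abs_of_nonneg (sub_nonneg.2 (hvφ y hyr))]
  linarith

end Superdifferential

variable {N : ℕ} {H : Space N → Space N → ℝ} {lam a : ℝ}

section Subsolution

variable {u : Space N → ℝ}

lemma isSubsolution_iff : IsSubsolution H lam a u ↔ UpperSemicontinuous u ∧
    ∀ x, ∀ p ∈ superdifferential u x, lam * u x + H x p ≤ a := by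
  refine and_congr_right fun _ => ⟨?_, fun h x φ hφ hmax =>
    h x _ (gradient_mem_superdifferential hφ hmax)⟩
  rintro h x _ ⟨φ, hφ, hle, hφx, rfl⟩
  refine h x φ hφ ?_
  filter_upwards [hle] with y hy
  linarith

lemma IsSubsolution.add_le (hu : IsSubsolution H lam a u) {x p : Space N}
    (hp : p ∈ superdifferential u x) : lam * u x + H x p ≤ a :=
  (isSubsolution_iff.1 hu).2 x p hp

lemma IsSubsolution.ham_le (hu : IsSubsolution H 0 a u) {x p : Space N}
    (hp : p ∈ superdifferential u x) : H x p ≤ a := by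
  simpa using hu.add_le hp

lemma isSubsolution_const {k : ℝ} (hk : ∀ x, lam * k + H x 0 ≤ a) :
    IsSubsolution H lam a fun _ => k := by
  refine isSubsolution_iff.2 ⟨continuous_const.upperSemicontinuous, fun x p hp => ?_⟩
  rw [eq_zero_of_mem_superdifferential_const hp]
  exact hk x

lemma isSubsolution_max_const {k : ℝ} (husc : UpperSemicontinuous u)
    (hu : ∀ x, k ≤ u x → ∀ p ∈ superdifferential u x, lam * u x + H x p ≤ a)
    (hk : ∀ x, u x < k → lam * k + H x 0 ≤ a) : IsSubsolution H lam a fun y => max (u y) k := by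
  refine isSubsolution_iff.2 ⟨husc.sup continuous_const.upperSemicontinuous, fun x p hp => ?_⟩
  rcases le_or_gt k (u x) with hx | hx
  · rw [max_eq_left hx]
    exact hu x hx p (superdifferential_subset_of_eventually_le
      (.of_forall fun _ => le_max_left _ _) (max_eq_left hx).symm hp)
  · have hp₀ : p = 0 := eq_zero_of_mem_superdifferential_const
      (superdifferential_subset_of_eventually_le
        (.of_forall fun _ => le_max_right _ _) (max_eq_right hx.le).symm hp)
    rw [max_eq_right hx.le, hp₀]
    exact hk x hx

lemma IsSubsolution.sub_const (hu : IsSubsolution H lam a u) (k : ℝ) :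
    IsSubsolution H lam (a - lam * k) fun y => u y - k := by
  refine isSubsolution_iff.2
    ⟨hu.1.add (continuous_const (y := -k)).upperSemicontinuous, fun x p hp => ?_⟩
  linarith [hu.add_le (superdifferential_sub_const_subset u k x hp)]

lemma IsSubsolution.of_le_add {lam' a' : ℝ} (hu : IsSubsolution H lam a u)
    (h : ∀ x, lam' * u x + a ≤ lam * u x + a') : IsSubsolution H lam' a' u :=
  ⟨hu.1, fun x φ hφ hmax => by linarith [hu.2 x φ hφ hmax, h x]⟩

end Subsolution

section Perron

variable {u : Space N → ℝ}

lemma isSubsolution_of_isLUB (hcont : HamContinuous H) {S : Set (Space N → ℝ)}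
    (hS : ∀ v ∈ S, IsSubsolution H lam a v) (husc : UpperSemicontinuous u)
    (hu : ∀ x, IsLUB ((fun v => v x) '' S) (u x)) : IsSubsolution H lam a u := by
  refine isSubsolution_iff.2 ⟨husc, fun x p hp => ?_⟩
  have hham : Continuous fun z : Space N × ℝ × Space N => lam * z.2.1 + H z.1 z.2.2 :=
    (by fun_prop : Continuous fun z : Space N × ℝ × Space N => lam * z.2.1).add
      (hcont.comp (continuous_fst.prodMk (continuous_snd.comp continuous_snd)))
  refine closure_minimal ?_ (isClosed_le hham continuous_const)
    (mem_closure_superdifferential_of_isLUB (fun v hv => (hS v hv).1) hu hp)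
  rintro z ⟨v, hv, hzv, hz⟩
  rw [mem_ofPred_eq, hzv]
  exact (hS v hv).add_le hz

lemma IsSubsolution.piecewise_max {ψ : Space N → ℝ} {U K : Set (Space N)} [DecidablePred (· ∈ U)]
    (hu : IsSubsolution H lam a u) (hU : IsOpen U) (hK : IsClosed K) (hKU : K ⊆ U)
    (hψ : ∀ x ∈ U, DifferentiableAt ℝ ψ x) (hsub : ∀ x ∈ U, lam * ψ x + H x (gradient ψ x) ≤ a)
    (hle : ∀ x ∈ U \ K, ψ x ≤ u x) :
    IsSubsolution H lam a (U.piecewise (fun y => max (u y) (ψ y)) u) := by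
  set w := U.piecewise (fun y => max (u y) (ψ y)) u
  have hw_in : ∀ x ∈ U, w x = max (u x) (ψ x) := fun x hx => piecewise_eq_of_mem _ _ _ hx
  have hw_out : ∀ x ∉ K, w x = u x := fun x hx => by
    by_cases hxU : x ∈ U
    · rw [hw_in x hxU, max_eq_left (hle x ⟨hxU, hx⟩)]
    · exact piecewise_eq_of_notMem _ _ _ hxU
  have huw : ∀ x, u x ≤ w x := fun x => by
    by_cases hxU : x ∈ U
    · exact (hw_in x hxU).symm ▸ le_max_left _ _
    · rw [hw_out x fun hxK => hxU (hKU hxK)]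
  refine isSubsolution_iff.2 ⟨fun x => ?_, fun x p hp => ?_⟩
  · by_cases hxU : x ∈ U
    · exact upperSemicontinuousAt_of_eventuallyEq
        (UpperSemicontinuousAt.sup (hu.1 x) (hψ x hxU).continuousAt.upperSemicontinuousAt)
        (eventually_of_mem (hU.mem_nhds hxU) fun y hy => (hw_in y hy).symm)
    · exact upperSemicontinuousAt_of_eventuallyEq (hu.1 x)
        (eventually_of_mem (hK.isOpen_compl.mem_nhds fun hxK => hxU (hKU hxK))
          fun y hy => (hw_out y hy).symm)
  · rcases (huw x).eq_or_lt with hx | hx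
    · exact hx ▸ hu.add_le (superdifferential_subset_of_eventually_le (.of_forall huw) hx hp)
    · have hxU : x ∈ U := hKU (by_contra fun hxK => hx.ne (hw_out x hxK).symm)
      have hwψ : w x = ψ x := by
        rw [hw_in x hxU] at hx ⊢
        exact max_eq_right_of_lt (by simpa using hx)
      have hψw : ∀ᶠ y in 𝓝 x, ψ y ≤ w y :=
        eventually_of_mem (hU.mem_nhds hxU) fun y hy => (hw_in y hy).symm ▸ le_max_right _ _
      have hpψ : p = gradient ψ x := superdifferential_subset_singleton (hψ x hxU)
        (superdifferential_subset_of_eventually_le hψw hwψ.symm hp)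
      rw [hwψ, hpψ]
      exact hsub x hxU

lemma eventually_nhds_prod_bump_isSubsolutionAt (hcont : HamContinuous H) {φ : Space N → ℝ}
    {x : Space N} (hφ : ContDiffAt ℝ 1 φ x) (hlt : lam * φ x + H x (gradient φ x) < a) :
    ∀ᶠ z : Space N × ℝ in 𝓝 (x, 0),
      DifferentiableAt ℝ (fun y => φ y + -1 * ‖y - x‖ ^ 2 + z.2) z.1 ∧
      lam * (φ z.1 + -1 * ‖z.1 - x‖ ^ 2 + z.2) +
        H z.1 (gradient (fun y => φ y + -1 * ‖y - x‖ ^ 2 + z.2) z.1) ≤ a := by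
  set F : Space N × ℝ → ℝ := fun z => lam * (φ z.1 + -1 * ‖z.1 - x‖ ^ 2 + z.2) +
    H z.1 (gradient φ z.1 + (2 * (-1 : ℝ)) • (z.1 - x)) with hF_def
  have hF : ContinuousAt F (x, 0) := by
    have hφ_fst : ContinuousAt (fun z : Space N × ℝ => φ z.1) (x, 0) := hφ.continuousAt.fst''
    have hgrad_fst : ContinuousAt (fun z : Space N × ℝ => gradient φ z.1) (x, 0) :=
      (continuousAt_gradient hφ).fst''
    exact ContinuousAt.add
      (continuousAt_const.mul ((hφ_fst.add (by fun_prop)).add continuousAt_snd))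
      (ContinuousAt.comp (g := fun z : Space N × Space N => H z.1 z.2) hcont.continuousAt
        (continuousAt_fst.prodMk (hgrad_fst.add (by fun_prop))))
  have hFx : F (x, 0) < a := by simpa [hF_def] using hlt
  filter_upwards [hF.eventually (gt_mem_nhds hFx), (eventually_contDiffAt hφ).prod_inl_nhds 0]
    with z hz hφz
  have hφd : DifferentiableAt ℝ φ z.1 := hφz.differentiableAt one_ne_zero
  have hsq : DifferentiableAt ℝ (fun y => -1 * ‖y - x‖ ^ 2) z.1 :=
    ((differentiableAt_id.sub_const x).norm_sq ℝ).const_mul (-1)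
  refine ⟨(hφd.add hsq).add_const _, ?_⟩
  rw [gradient, fderiv_add_const, ← gradient, gradient_add_mul_norm_sub_sq hφd]
  exact hz.le

lemma IsSubsolution.exists_lt (hcont : HamContinuous H) (hu : IsSubsolution H lam a u)
    {φ : Space N → ℝ} {x : Space N} (hφ : ContDiffAt ℝ 1 φ x) (hle : ∀ᶠ y in 𝓝 x, φ y ≤ u y)
    (hφx : φ x = u x) (hlt : lam * u x + H x (gradient φ x) < a) :
    ∃ w, IsSubsolution H lam a w ∧ u x < w x := by
  classical
  obtain ⟨r, hr, hP⟩ := exists_pos_forall_closedBall_of_eventually_nhds_prod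
    ((eventually_nhds_prod_bump_isSubsolutionAt hcont hφ (hφx ▸ hlt)).and (hle.prod_inl_nhds 0))
  set δ := (r / 2) ^ 2
  have hδ : 0 < δ := by positivity
  have hδr : |δ| ≤ r ^ 2 := by
    rw [abs_of_pos hδ]
    exact pow_le_pow_left₀ (by positivity) (by linarith) 2
  have hball : ∀ y ∈ ball x r, _ := fun y hy => hP y (ball_subset_closedBall hy) δ hδr
  refine ⟨_, hu.piecewise_max (ψ := fun y => φ y + -1 * ‖y - x‖ ^ 2 + δ) isOpen_ball
    (isClosed_closedBall (x := x) (ε := r / 2)) (closedBall_subset_ball (by linarith))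
    (fun y hy => (hball y hy).1.1) (fun y hy => (hball y hy).1.2) fun y hy => ?_, ?_⟩
  · have hδ_le : δ ≤ ‖y - x‖ ^ 2 := pow_le_pow_left₀ (by positivity)
      (not_le.1 (mt mem_closedBall_iff_norm.2 hy.2)).le 2
    linarith [(hball y hy.1).2]
  · rw [piecewise_eq_of_mem _ _ _ (mem_ball_self hr)]
    refine lt_max_of_lt_right ?_
    simpa [hφx] using hδ

lemma isSupersolution_of_forall_le (hcont : HamContinuous H) (hu : IsSubsolution H lam a u)
    (hlsc : LowerSemicontinuous u) (hmax : ∀ v, IsSubsolution H lam a v → ∀ x, v x ≤ u x) :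
    IsSupersolution H lam a u := by
  refine ⟨hlsc, fun x φ hφ hmin => ?_⟩
  by_contra! hlt
  have hgrad : gradient (fun y => φ y + (u x - φ x)) x = gradient φ x := by
    simp only [gradient, fderiv_add_const]
  obtain ⟨w, hw, huw⟩ := hu.exists_lt hcont (φ := fun y => φ y + (u x - φ x))
    (hφ.add contDiffAt_const) (hmin.mono fun y hy => by linarith) (by ring) (hgrad ▸ hlt)
  exact (hmax w hw x).not_gt huw

end Perron

section Coercive

lemma HamCoercive.exists_norm_le (hcoer : HamCoercive H) (R a : ℝ) :
    ∃ L : ℝ≥0, ∀ x ∈ ball (0 : Space N) R, ∀ p, H x p ≤ a → ‖p‖ ≤ L := by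
  have htop := EReal.tendsto_nhds_top_iff_real.1 (hcoer (max R 1) (by positivity)) a
  obtain ⟨r, hr, hr₀⟩ := (htop.and (eventually_ge_atTop 0)).exists
  refine ⟨⟨r, hr₀⟩, fun x hx p hp => ?_⟩
  by_contra! hlt
  have hp_mem : p ∈ (ball (0 : Space N) r)ᶜ := fun hpr => hlt.not_gt (mem_ball_zero_iff.1 hpr)
  have hle : ⨅ x ∈ ball (0 : Space N) (max R 1), ⨅ p ∈ (ball (0 : Space N) r)ᶜ, (H x p : EReal) ≤
      H x p := (iInf₂_le x (ball_subset_ball (le_max_left R 1) hx)).trans (iInf₂_le p hp_mem)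
  exact (EReal.coe_lt_coe_iff.1 (hr.trans_le hle)).not_ge hp

lemma HamCoercive.exists_forall_le (hcoer : HamCoercive H) (hcont : HamContinuous H)
    (x : Space N) : ∃ q, ∀ p, H x q ≤ H x p := by
  obtain ⟨L, hL⟩ := hcoer.exists_norm_le (‖x‖ + 1) (H x 0)
  have hx : Continuous (H x) := hcont.comp (continuous_const.prodMk continuous_id)
  refine hx.exists_forall_le' 0 (mem_of_superset
    (isCompact_closedBall (0 : Space N) L).compl_mem_cocompact fun p hp => ?_)
  by_contra hlt
  exact hp (mem_closedBall_zero_iff.2 (hL x (by simp) p (not_le.1 hlt).le))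

lemma HamCoercive.exists_lipschitzOnWith (hcoer : HamCoercive H) (R a : ℝ) :
    ∃ L : ℝ≥0, ∀ u, IsSubsolution H 0 a u → LipschitzOnWith L u (ball 0 R) := by
  obtain ⟨L, hL⟩ := hcoer.exists_norm_le (3 * R) a
  exact ⟨L, fun u hu => lipschitzOnWith_of_superdifferential hu.1
    fun y hy p hp => hL y hy p (hu.ham_le hp)⟩

lemma IsSubsolution.exists_ham_le (hcont : HamContinuous H) (hcoer : HamCoercive H)
    {u : Space N → ℝ} (hu : IsSubsolution H 0 a u) (x : Space N) : ∃ p, H x p ≤ a := by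
  by_contra! hlt
  obtain ⟨L, hL⟩ := hcoer.exists_norm_le (‖x‖ + 1) a
  have hgt : ∀ᶠ y in 𝓝 x, ∀ p ∈ closedBall (0 : Space N) L, a < H y p :=
    (isCompact_closedBall (0 : Space N) L).eventually_forall_of_forall_eventually
      fun p _ => hcont.continuousAt.eventually (lt_mem_nhds (hlt p))
  have hball : ∀ᶠ y in 𝓝 x, y ∈ ball (0 : Space N) (‖x‖ + 1) :=
    isOpen_ball.mem_nhds (by simp)
  obtain ⟨r, hr, hP⟩ := eventually_nhds_iff_ball.1 (hgt.and hball)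
  obtain ⟨y, hy, p, hp⟩ := exists_superdifferential_nonempty hu.1 x hr
  have hHp := hu.ham_le hp
  exact ((hP y hy).1 p (mem_closedBall_zero_iff.2 (hL y (hP y hy).2 p hHp))).not_ge hHp

end Coercive

section CriticalValue

lemma criticalValue_le (hcont : HamContinuous H) (hcoer : HamCoercive H) {u : Space N → ℝ}
    (hu : IsSubsolution H 0 a u) : criticalValue H ≤ a := by
  obtain ⟨q, hq⟩ := hcoer.exists_forall_le hcont 0
  refine csInf_le ⟨H 0 q, ?_⟩ ⟨u, hu⟩
  rintro b ⟨v, hv⟩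
  obtain ⟨p, hp⟩ := hv.exists_ham_le hcont hcoer 0
  exact (hq p).trans hp

lemma nonempty_subsolution_levels {C : ℝ} (hC : ∀ x, H x 0 ≤ C) :
    {a | ∃ u, IsSubsolution H 0 a u}.Nonempty :=
  ⟨C, _, isSubsolution_const (k := 0) (by simpa using hC)⟩

lemma le_criticalValue (hcont : HamContinuous H) (hcoer : HamCoercive H) {b C : ℝ} {x : Space N}
    (hC : ∀ x, H x 0 ≤ C) (hb : ∀ p, b ≤ H x p) : b ≤ criticalValue H := by
  refine le_csInf (nonempty_subsolution_levels hC) ?_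
  rintro a ⟨u, hu⟩
  obtain ⟨p, hp⟩ := hu.exists_ham_le hcont hcoer x
  exact (hb p).trans hp

lemma exists_isSubsolution_of_criticalValue_lt {C : ℝ} (hC : ∀ x, H x 0 ≤ C)
    (ha : criticalValue H < a) : ∃ u, IsSubsolution H 0 a u := by
  obtain ⟨b, ⟨u, hu⟩, hb⟩ := exists_lt_of_csInf_lt (nonempty_subsolution_levels hC) ha
  exact ⟨u, hu.of_le_add fun x => by linarith⟩

lemma HamContinuous.exists_forall_zero_le (hcont : HamContinuous H) {R : ℝ}
    (hout : ∀ x ∉ closedBall (0 : Space N) R, H x 0 ≤ a) : ∃ C, ∀ x, H x 0 ≤ C := by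
  have hzero : Continuous fun x : Space N => H x 0 :=
    hcont.comp (continuous_id.prodMk continuous_const)
  obtain ⟨C, hC⟩ := (isCompact_closedBall (0 : Space N) R).bddAbove_image hzero.continuousOn
  refine ⟨max C a, fun x => ?_⟩
  by_cases hx : x ∈ closedBall 0 R
  · exact (hC (mem_image_of_mem _ hx)).trans (le_max_left _ _)
  · exact (hout x hx).trans (le_max_right _ _)

lemma exists_forall_notMem_closedBall_zero_le (hcont : HamContinuous H) (hcoer : HamCoercive H)
    (hinf : limsup (fun x => (H x 0 : EReal)) (cocompact (Space N)) <
      ⨆ x, ⨅ p, (H x p : EReal)) :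
    ∃ R > 0, ∃ a < criticalValue H, ∀ x ∉ closedBall (0 : Space N) R, H x 0 ≤ a := by
  obtain ⟨x, hx⟩ := lt_iSup_iff.1 hinf
  obtain ⟨a, ha_gt, ha_lt⟩ := EReal.lt_iff_exists_real_btwn.1 hx
  obtain ⟨r, hr⟩ := closedBall_compl_subset_of_mem_cocompact (eventually_lt_of_limsup_lt ha_gt) 0
  have hout : ∀ y ∉ closedBall (0 : Space N) (max r 1), H y 0 ≤ a := fun y hy =>
    (EReal.coe_lt_coe_iff.1 (hr fun hyr =>
      hy (closedBall_subset_closedBall (le_max_left r 1) hyr))).le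
  obtain ⟨C, hC⟩ := hcont.exists_forall_zero_le hout
  obtain ⟨q, hq⟩ := hcoer.exists_forall_le hcont x
  have haq : a < H x q := EReal.coe_lt_coe_iff.1 (ha_lt.trans_le (iInf_le _ q))
  exact ⟨max r 1, by positivity, a, haq.trans_le (le_criticalValue hcont hcoer hC hq), hout⟩

lemma HamInfinity.limsup_zero_lt (hinf : HamInfinity H) :
    limsup (fun x => (H x 0 : EReal)) (cocompact (Space N)) < ⨆ x, ⨅ p, (H x p : EReal) := by
  obtain ⟨ε, hε, hlt⟩ := hinf
  refine (limsup_le_limsup (.of_forall fun x => ?_)).trans_lt hlt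
  exact le_iSup₂ (f := fun p (_ : p ∈ ball (0 : Space N) ε) => (H x p : EReal)) 0
    (mem_ball_self hε)

end CriticalValue

section BoundedSubsolutions

/-- An increasing compression of the line into `(-∞, 1)` that is the identity on `(-∞, 0]`. On
`[0, ∞)` its inverse `s ↦ (1 - s)⁻¹ - 1` has slope at least one, so that subsolutions remain
subsolutions after compression wherever constants are subsolutions. -/
noncomputable def compress (t : ℝ) : ℝ := min t 0 + (1 - (1 + max t 0)⁻¹)

lemma compress_of_nonpos {t : ℝ} (ht : t ≤ 0) : compress t = t := by simp [compress, ht]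

lemma one_sub_compress_of_nonneg {t : ℝ} (ht : 0 ≤ t) : 1 - compress t = (1 + t)⁻¹ := by
  simp [compress, ht]

lemma monotone_compress : Monotone compress := fun s t hst => by
  unfold compress
  gcongr

lemma continuous_compress : Continuous compress := by
  unfold compress
  fun_prop (disch := intros; positivity)

lemma compress_lt_one (t : ℝ) : compress t < 1 := by
  have hpos : 0 < (1 + max t 0)⁻¹ := by positivity
  unfold compress
  linarith [min_le_right t 0]

lemma le_inv_one_sub_compress_sub_one (t : ℝ) : t ≤ (1 - compress t)⁻¹ - 1 := by
  rcases le_total t 0 with ht | ht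
  · have hpos : 0 < 1 - t := by linarith
    rw [compress_of_nonpos ht, le_sub_iff_add_le, ← one_div, le_div_iff₀ hpos]
    linarith [mul_self_nonneg t]
  · rw [one_sub_compress_of_nonneg ht, inv_inv, add_sub_cancel_left]

lemma inv_sq_smul_mem_superdifferential_of_compress {E : Type*} [NormedAddCommGroup E]
    [InnerProductSpace ℝ E] [CompleteSpace E] {w : E → ℝ} {x p : E} (hx : 0 ≤ w x)
    (hp : p ∈ superdifferential (fun y => compress (w y)) x) :
    ((1 - compress (w x)) ^ 2)⁻¹ • p ∈ superdifferential w x := by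
  have hne : 1 - compress (w x) ≠ 0 := (sub_pos.2 (compress_lt_one _)).ne'
  have hderiv : HasDerivAt (fun s : ℝ => (1 - s)⁻¹ - 1) ((1 - compress (w x)) ^ 2)⁻¹
      (compress (w x)) := by
    simpa using (((hasDerivAt_id _).const_sub 1).fun_inv hne).sub_const 1
  have hmono : MonotoneOn (fun s : ℝ => (1 - s)⁻¹ - 1) (Iio 1) := fun s _ t ht hst =>
    sub_le_sub_right (inv_anti₀ (sub_pos.2 ht) (sub_le_sub_left hst 1)) 1
  have hmem := smul_mem_superdifferential_comp (v := fun y => compress (w y))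
    (Iio_mem_nhds (compress_lt_one _)) hmono
    (((contDiffAt_const.sub contDiffAt_id).inv hne).sub contDiffAt_const)
    (.of_forall fun _ => compress_lt_one _) hp
  rw [hderiv.deriv] at hmem
  refine superdifferential_subset_of_eventually_le
    (.of_forall fun _ => le_inv_one_sub_compress_sub_one _) ?_ hmem
  rw [one_sub_compress_of_nonneg hx, inv_inv, add_sub_cancel_left]

lemma IsSubsolution.compress {w : Space N → ℝ} (hquasi : ∀ x, QuasiconvexOn ℝ univ (H x))
    (hw : IsSubsolution H 0 a w) (hzero : ∀ x, 0 ≤ w x → H x 0 ≤ a) :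
    IsSubsolution H 0 a fun y => compress (w y) := by
  refine isSubsolution_iff.2 ⟨continuous_compress.comp_upperSemicontinuous hw.1 monotone_compress,
    fun x p hp => ?_⟩
  rw [zero_mul, zero_add]
  rcases lt_or_ge (w x) 0 with hx | hx
  · refine hw.ham_le (superdifferential_subset_of_eventually_le ?_
      (compress_of_nonpos hx.le).symm hp)
    filter_upwards [hw.1 x 0 hx] with y hy
    exact (compress_of_nonpos hy.le).ge
  · have hham := hw.ham_le (inv_sq_smul_mem_superdifferential_of_compress hx hp)
    rw [one_sub_compress_of_nonneg hx] at hham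
    have hpos : 0 < (1 + w x)⁻¹ := by positivity
    have hscale : ((1 + w x)⁻¹) ^ 2 ∈ Icc (0 : ℝ) 1 :=
      ⟨by positivity, pow_le_one₀ hpos.le (inv_le_one_of_one_le₀ (by linarith))⟩
    have hconv := (hquasi x a).smul_mem_of_zero_mem ⟨mem_univ _, hzero x hx⟩
      ⟨mem_univ _, hham⟩ hscale
    rw [smul_inv_smul₀ (pow_pos hpos 2).ne'] at hconv
    exact hconv.2

lemma HamCoercive.exists_sub_const_mem_Ico (hcoer : HamCoercive H) (R a : ℝ) :
    ∃ K, ∀ u, IsSubsolution H 0 a u →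
      ∃ k, ∀ x ∈ closedBall (0 : Space N) R, u x - k ∈ Ico (-K) 0 := by
  obtain ⟨L, hL⟩ := hcoer.exists_lipschitzOnWith (R + 1) a
  refine ⟨2 * (L * R) + 1, fun u hu => ⟨u 0 + L * R + 1, fun x hx => ?_⟩⟩
  have hxR : dist x 0 ≤ R := hx
  have hR : 0 ≤ R := dist_nonneg.trans hxR
  have hdist : dist (u x) (u 0) ≤ L * R :=
    ((hL u hu).dist_le_mul x (mem_ball.2 (by linarith)) 0 (mem_ball_self (by linarith))).trans
      (mul_le_mul_of_nonneg_left hxR L.coe_nonneg)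
  rw [Real.dist_eq, abs_le] at hdist
  constructor <;> linarith

lemma IsSubsolution.exists_mem_Icc (hquasi : ∀ x, QuasiconvexOn ℝ univ (H x)) {u : Space N → ℝ}
    {R K k : ℝ} (hu : IsSubsolution H 0 a u) (hR : 0 ≤ R)
    (hk : ∀ x ∈ closedBall (0 : Space N) R, u x - k ∈ Ico (-K) 0)
    (hout : ∀ x ∉ closedBall (0 : Space N) R, H x 0 ≤ a) :
    ∃ v, IsSubsolution H 0 a v ∧ ∀ x, v x ∈ Icc (-K) 1 := by
  have hK : -K < 0 := (hk 0 (mem_closedBall_self hR)).1.trans_lt (hk 0 (mem_closedBall_self hR)).2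
  have hshift : IsSubsolution H 0 a fun y => u y - k := by simpa using hu.sub_const k
  have hcompress := hshift.compress hquasi fun x hx =>
    hout x fun hxR => hx.not_gt (hk x hxR).2
  refine ⟨fun y => max (DiscountedHJ.compress (u y - k)) (-K), isSubsolution_max_const hcompress.1
    (fun x _ p hp => hcompress.add_le hp) (fun x hx => ?_), fun x => ⟨le_max_right _ _,
    max_le (compress_lt_one _).le (by linarith)⟩⟩
  rw [zero_mul, zero_add]
  refine hout x fun hxR => ?_
  rw [compress_of_nonpos (hk x hxR).2.le] at hx
  exact hx.not_ge (hk x hxR).1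

lemma exists_equibounded_isSubsolution (hquasi : ∀ x, QuasiconvexOn ℝ univ (H x))
    (hcoer : HamCoercive H) {R C : ℝ} (hR : 0 ≤ R) (hC : ∀ x, H x 0 ≤ C)
    (hout : ∀ x ∉ closedBall (0 : Space N) R, H x 0 ≤ criticalValue H) :
    ∃ m, ∀ lam > 0, ∃ v, IsSubsolution H lam (criticalValue H) v ∧ ∀ x, m ≤ v x := by
  obtain ⟨K, hK⟩ := hcoer.exists_sub_const_mem_Ico R (criticalValue H + 1)
  refine ⟨-K - 2, fun lam hlam => ?_⟩
  have hη : criticalValue H < criticalValue H + min lam 1 :=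
    lt_add_of_pos_right _ (lt_min hlam one_pos)
  obtain ⟨u, hu⟩ := exists_isSubsolution_of_criticalValue_lt hC hη
  obtain ⟨k, hk⟩ := hK u (hu.of_le_add fun x => by linarith [min_le_right lam 1])
  obtain ⟨v, hv, hv_mem⟩ := hu.exists_mem_Icc hquasi hR hk fun x hx => (hout x hx).trans hη.le
  refine ⟨fun y => v y - 2, (hv.sub_const 2).of_le_add fun x => ?_, fun x => ?_⟩
  · have hle : lam * (v x - 2) ≤ lam * (-1) :=
      mul_le_mul_of_nonneg_left (by linarith [(hv_mem x).2]) hlam.le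
    linarith [min_le_left lam 1]
  · linarith [(hv_mem x).1]

end BoundedSubsolutions

section MaximalSolution

lemma IsSubsolution.exists_nonpos (hcont : HamContinuous H) (hcoer : HamCoercive H)
    {v : Space N → ℝ} {R : ℝ} (hv : IsSubsolution H lam (criticalValue H) v) (hlam : 0 < lam)
    (hR : 0 ≤ R) (hvR : ContinuousOn v (closedBall 0 R)) (ha : a < criticalValue H)
    (hout : ∀ x ∉ closedBall (0 : Space N) R, H x 0 ≤ a) :
    ∃ x ∈ closedBall (0 : Space N) R, v x ≤ 0 := by
  by_contra! hpos
  obtain ⟨z, hz, hmin⟩ := (isCompact_closedBall (0 : Space N) R).exists_isMinOn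
    ⟨0, mem_closedBall_self hR⟩ hvR
  have hvz := hpos z hz
  have hsub : IsSubsolution H 0 (max a (criticalValue H - lam * (v z / 2)))
      fun y => max (v y) (v z / 2) := by
    refine isSubsolution_max_const hv.1 (fun x hx p hp => ?_) fun x hx => ?_
    · have hle : lam * (v z / 2) ≤ lam * v x := mul_le_mul_of_nonneg_left hx hlam.le
      linarith [hv.add_le hp, le_max_right a (criticalValue H - lam * (v z / 2))]
    · rw [zero_mul, zero_add]
      refine (hout x fun hxR => ?_).trans (le_max_left _ _)
      have hzx : v z ≤ v x := hmin hxR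
      linarith
  have hlt : max a (criticalValue H - lam * (v z / 2)) < criticalValue H :=
    max_lt ha (sub_lt_self _ (by positivity))
  exact (criticalValue_le hcont hcoer hsub).not_gt hlt

/-- The subsolutions of `lam * u + H(x, Du) = a` with `lam * u ≥ -C`. Perron's method is applied
to this family, which is locally equi-Lipschitz because its members satisfy `H(x, Du) ≤ a + C`. -/
def perronFamily (H : Space N → Space N → ℝ) (lam a C : ℝ) : Set (Space N → ℝ) :=
  {v | IsSubsolution H lam a v ∧ ∀ x, -C ≤ lam * v x}

variable {C : ℝ} {v : Space N → ℝ}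

lemma isSubsolution_zero_of_mem_perronFamily (hv : v ∈ perronFamily H lam a C) :
    IsSubsolution H 0 (a + C) v :=
  hv.1.of_le_add fun x => by linarith [hv.2 x]

lemma perronFamily_nonempty (hlam : 0 < lam) (hC : ∀ x, H x 0 ≤ a + C) :
    (perronFamily H lam a C).Nonempty := by
  have hk : lam * (-C / lam) = -C := mul_div_cancel₀ _ hlam.ne'
  exact ⟨fun _ => -C / lam, isSubsolution_const fun x => by linarith [hC x], fun _ => hk.ge⟩

lemma IsSubsolution.max_const_mem_perronFamily (hv : IsSubsolution H lam a v) (hlam : 0 < lam)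
    (hC : ∀ x, H x 0 ≤ a + C) : (fun y => max (v y) (-C / lam)) ∈ perronFamily H lam a C := by
  have hk : lam * (-C / lam) = -C := mul_div_cancel₀ _ hlam.ne'
  refine ⟨isSubsolution_max_const hv.1 (fun x _ p hp => hv.add_le hp)
    fun x _ => by linarith [hC x], fun x => hk.ge.trans ?_⟩
  exact mul_le_mul_of_nonneg_left (le_max_right _ _) hlam.le

lemma exists_forall_perronFamily_le (hcont : HamContinuous H) (hcoer : HamCoercive H) {R₀ : ℝ}
    (hR₀ : 0 ≤ R₀) (ha : a < criticalValue H)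
    (hout : ∀ x ∉ closedBall (0 : Space N) R₀, H x 0 ≤ a) (C R : ℝ) :
    ∃ B, ∀ lam > 0, ∀ v ∈ perronFamily H lam (criticalValue H) C,
      ∀ x ∈ ball (0 : Space N) R, v x ≤ B := by
  obtain ⟨L, hL⟩ := hcoer.exists_lipschitzOnWith (max R (R₀ + 1)) (criticalValue H + C)
  refine ⟨L * (R + R₀), fun lam hlam v hv x hx => ?_⟩
  have hlip := hL v (isSubsolution_zero_of_mem_perronFamily hv)
  have hsub : closedBall (0 : Space N) R₀ ⊆ ball 0 (max R (R₀ + 1)) :=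
    closedBall_subset_ball (lt_max_of_lt_right (lt_add_one R₀))
  obtain ⟨z, hz, hvz⟩ := hv.1.exists_nonpos hcont hcoer hlam hR₀ (hlip.continuousOn.mono hsub) ha
    hout
  have hdist : dist x z ≤ R + R₀ := (dist_triangle_right x z 0).trans
    (add_le_add (mem_ball.1 hx).le hz)
  have hvx := hlip.le_add_mul (ball_subset_ball (le_max_left _ _) hx) (hsub hz)
  linarith [mul_le_mul_of_nonneg_left hdist L.coe_nonneg]

lemma isMaximalSolution_of_isLUB_perronFamily (hcont : HamContinuous H) (hlam : 0 < lam)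
    (hC : ∀ x, H x 0 ≤ a + C) {u : Space N → ℝ} (hu_cont : Continuous u)
    (hu : ∀ x, IsLUB ((fun v => v x) '' perronFamily H lam a C) (u x)) :
    IsMaximalSolution H lam a u := by
  have hsub : IsSubsolution H lam a u :=
    isSubsolution_of_isLUB hcont (fun v hv => hv.1) hu_cont.upperSemicontinuous hu
  have hmax : ∀ v, IsSubsolution H lam a v → ∀ x, v x ≤ u x := fun v hv x =>
    (le_max_left _ _).trans
      ((hu x).1 (mem_image_of_mem _ (hv.max_const_mem_perronFamily hlam hC)))
  exact ⟨⟨hsub, isSupersolution_of_forall_le hcont hsub hu_cont.lowerSemicontinuous hmax⟩, hmax⟩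

lemma exists_isMaximalSolution (hcont : HamContinuous H)
    (hquasi : ∀ x, QuasiconvexOn ℝ univ (H x)) (hcoer : HamCoercive H)
    (hinf : limsup (fun x => (H x 0 : EReal)) (cocompact (Space N)) <
      ⨆ x, ⨅ p, (H x p : EReal)) :
    ∃ (m : ℝ) (L : ℝ → ℝ≥0) (B : ℝ → ℝ), ∀ lam > 0, ∃ u : C(Space N, ℝ),
      IsMaximalSolution H lam (criticalValue H) u ∧
        ∀ R, LipschitzOnWith (L R) u (ball 0 R) ∧ ∀ x ∈ ball 0 R, u x ∈ Icc m (B R) := by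
  obtain ⟨R₀, hR₀, a, ha, hout⟩ := exists_forall_notMem_closedBall_zero_le hcont hcoer hinf
  obtain ⟨M, hM⟩ := hcont.exists_forall_zero_le hout
  obtain ⟨C, rfl⟩ : ∃ C, criticalValue H + C = M := ⟨M - criticalValue H, add_sub_cancel _ _⟩
  obtain ⟨m, hm⟩ := exists_equibounded_isSubsolution hquasi hcoer hR₀.le hM
    fun x hx => (hout x hx).trans ha.le
  choose L hL using fun R => hcoer.exists_lipschitzOnWith R (criticalValue H + C)
  choose B hB using exists_forall_perronFamily_le hcont hcoer hR₀.le ha hout C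
  refine ⟨m, L, B, fun lam hlam => ?_⟩
  set F := perronFamily H lam (criticalValue H) C
  have hF : F.Nonempty := perronFamily_nonempty hlam hM
  have hFB : ∀ R, ∀ x ∈ ball (0 : Space N) R, B R ∈ upperBounds ((fun v => v x) '' F) :=
    fun R x hx => forall_mem_image.2 fun v hv => hB R lam hlam v hv x hx
  have hu : ∀ x, IsLUB ((fun v => v x) '' F) (sSup ((fun v => v x) '' F)) := fun x =>
    isLUB_csSup (hF.image _) ⟨_, hFB (dist x 0 + 1) x (mem_ball.2 (lt_add_one _))⟩
  have hlip : ∀ R, LipschitzOnWith (L R) (fun x => sSup ((fun v => v x) '' F)) (ball 0 R) :=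
    fun R => lipschitzOnWith_of_isLUB
      (fun v hv => hL R v (isSubsolution_zero_of_mem_perronFamily hv)) fun x _ => hu x
  have hu_cont := (locallyLipschitz_of_lipschitzOnWith_ball 0 fun R => ⟨L R, hlip R⟩).continuous
  have hmax := isMaximalSolution_of_isLUB_perronFamily hcont hlam hM hu_cont hu
  obtain ⟨v, hv, hmv⟩ := hm lam hlam
  exact ⟨⟨_, hu_cont⟩, hmax, fun R => ⟨hlip R, fun x hx =>
    ⟨(hmv x).trans (hmax.2 v hv x), (hu x).2 (hFB R x hx)⟩⟩⟩

end MaximalSolution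

end DiscountedHJ

theorem mainTheorem10_general {N : ℕ}
    (H : DiscountedHJ.Space N → DiscountedHJ.Space N → ℝ)
    (hcont : DiscountedHJ.HamContinuous H)
    (hquasi : ∀ x, QuasiconvexOn ℝ Set.univ (H x))
    (hcoer : DiscountedHJ.HamCoercive H)
    (hinf : Filter.limsup (fun x => (H x 0 : EReal)) (Filter.cocompact (DiscountedHJ.Space N)) <
      ⨆ x, ⨅ p, (H x p : EReal)) :
    ∃ u : ℝ → C(DiscountedHJ.Space N, ℝ),
      (∀ lam : ℝ, 0 < lam →
        DiscountedHJ.IsMaximalSolution H lam (DiscountedHJ.criticalValue H) (u lam) ∧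
          LocallyLipschitz (u lam)) ∧
      (∃ m : ℝ, ∀ lam : ℝ, 0 < lam → ∀ x, m ≤ u lam x) ∧
      IsCompact (closure (u '' Set.Ioi 0)) := by
  obtain ⟨m, L, B, h⟩ := DiscountedHJ.exists_isMaximalSolution hcont hquasi hcoer hinf
  choose! u hmax hu using h
  have hball : ∀ x : DiscountedHJ.Space N, x ∈ Metric.ball 0 (dist x 0 + 1) := fun x =>
    Metric.mem_ball.2 (lt_add_one _)
  refine ⟨u, fun lam hlam => ⟨hmax lam hlam,
    DiscountedHJ.locallyLipschitz_of_lipschitzOnWith_ball 0 fun R => ⟨L R, (hu lam hlam R).1⟩⟩,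
    ⟨m, fun lam hlam x => ((hu lam hlam _).2 x (hball x)).1⟩,
    DiscountedHJ.isCompact_closure_of_equicontinuous ?_ fun x =>
      ⟨Set.Icc m (B (dist x 0 + 1)), isCompact_Icc, ?_⟩⟩
  · refine DiscountedHJ.equicontinuous_of_lipschitzOnWith_nhds fun x =>
      ⟨L (dist x 0 + 1), _, Metric.isOpen_ball.mem_nhds (hball x), ?_⟩
    rintro ⟨_, lam, hlam, rfl⟩
    exact (hu lam hlam _).1
  · rintro _ ⟨lam, hlam, rfl⟩
    exact (hu lam hlam _).2 x (hball x)

theorem mainTheorem10 {N : ℕ}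
    (H : DiscountedHJ.Space N → DiscountedHJ.Space N → ℝ)
    (hcont : DiscountedHJ.HamContinuous H)
    (hconv : DiscountedHJ.HamConvex H)
    (hcoer : DiscountedHJ.HamCoercive H)
    (hinf : DiscountedHJ.HamInfinity H) :
    ∃ u : ℝ → C(DiscountedHJ.Space N, ℝ),
      (∀ lam : ℝ, 0 < lam →
        DiscountedHJ.IsMaximalSolution H lam (DiscountedHJ.criticalValue H) (u lam) ∧
          LocallyLipschitz (u lam)) ∧
      (∃ m : ℝ, ∀ lam : ℝ, 0 < lam → ∀ x, m ≤ u lam x) ∧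
      IsCompact (closure (u '' Set.Ioi 0)) :=
  mainTheorem10_general H hcont (fun x => (hconv x).quasiconvexOn) hcoer hinf.limsup_zero_lt
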